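/- **Setting.** Let $T>0$, let $(\Omega,\mathcal F,(\mathcal F_t)_{t\in[0,T]},\mathbb P)$ be a filtered probability space, and let $\nu$ be a finite measure on $\mathbb R^d$ with $\nu(\{0\})=0$ and $\int_{\mathbb R^d}|z|^2\,\nu(\mathrm dz)<\infty$. Let $W$ be an $\mathbb R^d$-valued standard Brownian motion on $[0,T]$ and $N$ a Poisson random measure on $[0,T]\times\mathbb R^d$ with intensity $\mathrm dt\otimes\nu(\mathrm dz)$, both adapted to $(\mathcal F_t)$ and such that, for every $s\in[0,T]$, the increments of $(W,N)$ after time $s$ are (jointly) independent of $\mathcal F_s$. Put $\widetilde N(\mathrm dt,\mathrm dz)=N(\mathrm dt,\mathrm dz)-\nu(\mathrm dz)\,\mathrm dt$. Let $b:\mathbb R^d\to\mathbb R^d$, $\sigma,\gamma:\mathbb R^d\to\mathbb R^{d\times d}$ and $g:\mathbb R^d\to\mathbb R$ be Lipschitz continuous, and let $f:[0,T]\times\mathbb R^d\times\mathbb R\times\mathbb R^d\times\mathbb R\to\mathbb R$ satisfy, for some $K_f>0$ and all $t\in[0,T]$ and all arguments, $$|f(t,x,y,z,u)-f(t,x',y',z',u')|\le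 K_f\big(|x-x'|+|y-y'|+|z-z'|+|u-u'|\big).$$ Fix $x\in\mathbb R^d$ and an integer $M\ge1$, and put $\Delta t=T/M$, $t_n=n\Delta t$, $\mathcal F_n=\mathcal F_{t_n}$, $\Delta W_n=W_{t_{n+1}}-W_{t_n}$. Define $\widetilde X_0=x$ and, for $n=0,\dots,M-1$, $$\widetilde X_{n+1}=\widetilde X_n+b(\widetilde X_n)\Delta t+\sigma(\widetilde X_n)^{\top}\Delta W_n+\int_{t_n}^{t_{n+1}}\!\!\int_{\mathbb R^d}\gamma(\widetilde X_n)z\,\widetilde N(\mathrm dr,\mathrm dz).$$ **Lemma 4.3.** If $\Delta t<1/K_f$, then there exist deterministic measurable functions $\widetilde U_n:\mathbb R^d\to\mathbb R$, $\widetilde V_n:\mathbb R^d\to\mathbb R^d$, $\widetilde L_n:\mathbb R^d\to\mathbb R$, $n=0,\dots,M$, such that $\widetilde Y'_n:=\widetilde U_n(\widetilde X_n)$, $\widetilde Z'_n:=\widetilde V_n(\widetilde X_n)$ and $\widetilde\Psi'_n:=\widetilde L_n(\widetilde X_n)$ are square-integrable, $\widetilde Z'_M=\widetilde\Psi'_M=0$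 and, almost surely, $$\begin{cases}\widetilde Y'_M=g(\widetilde X_M),\\[2pt] \widetilde Z'_n=\frac1{\Delta t}\,\mathbb E\big[\widetilde Y'_{n+1}\,\Delta W_n\,\big|\,\mathcal F_n\big],\\[2pt] \widetilde\Psi'_n=\frac1{\Delta t}\,\mathbb E\Big[\widetilde Y'_{n+1}\int_{t_n}^{t_{n+1}}\!\int_{\mathbb R^d}\widetilde N(\mathrm dr,\mathrm dz)\,\Big|\,\mathcal F_n\Big],\\[2pt] \widetilde Y'_n=\mathbb E\big[\widetilde Y'_{n+1}\,\big|\,\mathcal F_n\big]+f\big(t_n,\widetilde X_n,\widetilde Y'_n,\widetilde Z'_n,\widetilde\Psi'_n\big)\Delta t\end{cases}$$ for $n=0,\dots,M-1$. -/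

import Mathlib

open MeasureTheory ProbabilityTheory Set
open scoped NNReal ENNReal

noncomputable section

/-- A Lévy measure `ν` on `ℝᵈ` that integrates `|z|²` over the large jumps. -/
structure IsSquareIntegrableLevyMeasure {d : ℕ} (ν : Measure (EuclideanSpace ℝ (Fin d))) :
    Prop where
  zero : ν {0} = 0
  small_jumps : ∫⁻ z, min 1 (‖z‖ₑ ^ 2) ∂ν < ∞
  large_jumps : ∫⁻ z in {z | 1 ≤ ‖z‖}, ‖z‖ₑ ^ 2 ∂ν < ∞

/-- `N` is a Poisson random measure on `S` with intensity measure `μ`. -/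
structure IsPoissonRandomMeasure {Ω S : Type*} [MeasurableSpace Ω] [MeasurableSpace S]
    (N : Ω → Measure S) (μ : Measure S) (P : Measure Ω) : Prop where
  measurable : Measurable N
  law : ∀ A, MeasurableSet A → μ A < ∞ →
    HasLaw (fun ω ↦ N ω A) ((poissonMeasure (μ A).toNNReal).map (fun k : ℕ ↦ (k : ℝ≥0∞))) P
  top : ∀ A, MeasurableSet A → μ A = ∞ → ∀ᵐ ω ∂P, N ω A = ∞
  indep : ∀ (k : ℕ) (A : Fin k → Set S), (∀ i, MeasurableSet (A i)) →
    Pairwise (fun i j ↦ Disjoint (A i) (A j)) → iIndepFun (fun i ω ↦ N ω (A i)) P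

/-- The σ-algebra generated by the increments after time `s` of the pair `(W, N)`: by
`W u - W s` for `s ≤ u ≤ T` and by `N A` for the measurable sets `A ⊆ (s, T] × ℝᵈ`. -/
abbrev futureNoise {d : ℕ} {Ω : Type*} (W : ℝ → Ω → EuclideanSpace ℝ (Fin d))
    (N : Ω → Measure (ℝ × EuclideanSpace ℝ (Fin d))) (T s : ℝ) : MeasurableSpace Ω :=
  (⨆ u ∈ Icc s T, MeasurableSpace.comap (fun ω ↦ W u ω - W s ω) inferInstance) ⊔
  (⨆ A ∈ {A : Set (ℝ × EuclideanSpace ℝ (Fin d)) | MeasurableSet A ∧ A ⊆ Ioc s T ×ˢ univ},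
    MeasurableSpace.comap (fun ω ↦ N ω A) inferInstance)

/-- With respect to the filtration `F`, on the time interval `[0, T]`, `W` is a standard
`d`-dimensional Brownian motion and `N` is a Poisson random measure on `[0, T] × ℝᵈ` with
intensity `dt ⊗ ν(dz)`. Both are adapted, and the increments of `(W, N)` after time `s` are
independent of `F s`. Only the times in `[0, T]` matter: nothing is required of `W` and `F` at
other times. -/
structure IsBrownianPoissonNoise {d : ℕ} {Ω : Type*} [mΩ : MeasurableSpace Ω] (P : Measure Ω)
    (T : ℝ) (F : Filtration ℝ mΩ) (W : ℝ → Ω → EuclideanSpace ℝ (Fin d))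
    (N : Ω → Measure (ℝ × EuclideanSpace ℝ (Fin d)))
    (ν : Measure (EuclideanSpace ℝ (Fin d))) : Prop where
  W_zero : ∀ᵐ ω ∂P, W 0 ω = 0
  W_adapted : ∀ t ∈ Icc 0 T, Measurable[F t] (W t)
  W_law : ∀ s t, 0 ≤ s → s ≤ t → t ≤ T →
    HasLaw (fun ω ↦ W t ω - W s ω)
      ((stdGaussian (EuclideanSpace ℝ (Fin d))).map (fun w ↦ √(t - s) • w)) P
  W_continuous : ∀ᵐ ω ∂P, ContinuousOn (fun t ↦ W t ω) (Icc 0 T)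
  N_poisson : IsPoissonRandomMeasure N ((volume.restrict (Icc 0 T)).prod ν) P
  N_adapted : ∀ t ∈ Icc 0 T, ∀ A, MeasurableSet A → A ⊆ Icc 0 t ×ˢ univ →
    Measurable[F t] (fun ω ↦ N ω A)
  indep : ∀ s ∈ Icc 0 T, Indep (F s) (futureNoise W N T s) P

/-- The pathwise integral `∫_s^t ∫ h(z) Ñ(dr, dz)` of a time-independent integrand `h` against
the compensated measure `Ñ(dr, dz) = N(dr, dz) - ν(dz) dr` (for finite `ν`). -/
def compensatedIntegral {d : ℕ} {Ω G : Type*} [NormedAddCommGroup G] [NormedSpace ℝ G]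
    (N : Ω → Measure (ℝ × EuclideanSpace ℝ (Fin d))) (ν : Measure (EuclideanSpace ℝ (Fin d)))
    (s t : ℝ) (h : EuclideanSpace ℝ (Fin d) → G) (ω : Ω) : G :=
  (∫ p in Ioc s t ×ˢ univ, h p.2 ∂(N ω)) - (t - s) • ∫ z, h z ∂ν

/-- The step size `Δt = T / M`. -/
def stepSize (T : ℝ) (M : ℕ) : ℝ := T / M

/-- The grid points `t_n = n Δt`. -/
def gridPoint (T : ℝ) (M n : ℕ) : ℝ := n * stepSize T M

/-- The Brownian increment `ΔW_n`. -/
def brownianIncrement {d : ℕ} {Ω : Type*} (W : ℝ → Ω → EuclideanSpace ℝ (Fin d)) (T : ℝ)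
    (M n : ℕ) (ω : Ω) : EuclideanSpace ℝ (Fin d) :=
  W (gridPoint T M (n + 1)) ω - W (gridPoint T M n) ω

/-- The increment `∫_{t_n}^{t_{n+1}} ∫ Ñ(dr, dz)` of the compensated number of jumps. -/
def compensatedJumpIncrement {d : ℕ} {Ω : Type*}
    (N : Ω → Measure (ℝ × EuclideanSpace ℝ (Fin d))) (ν : Measure (EuclideanSpace ℝ (Fin d)))
    (T : ℝ) (M n : ℕ) (ω : Ω) : ℝ :=
  compensatedIntegral N ν (gridPoint T M n) (gridPoint T M (n + 1)) (fun _ ↦ (1 : ℝ)) ω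

/-- The Euler scheme `X₀ = x`,
`X_{n+1} = X_n + b(X_n) Δt + σ(X_n)ᵀ ΔW_n + ∫_{t_n}^{t_{n+1}} ∫ γ(X_n) z Ñ(dr, dz)`. -/
def eulerScheme {d : ℕ} {Ω : Type*} (T : ℝ) (M : ℕ) (W : ℝ → Ω → EuclideanSpace ℝ (Fin d))
    (N : Ω → Measure (ℝ × EuclideanSpace ℝ (Fin d))) (ν : Measure (EuclideanSpace ℝ (Fin d)))
    (b : EuclideanSpace ℝ (Fin d) → EuclideanSpace ℝ (Fin d))
    (σ γ : EuclideanSpace ℝ (Fin d) → Matrix (Fin d) (Fin d) ℝ)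
    (x : EuclideanSpace ℝ (Fin d)) : ℕ → Ω → EuclideanSpace ℝ (Fin d)
  | 0, _ => x
  | n + 1, ω =>
    let X := eulerScheme T M W N ν b σ γ x n ω
    X + stepSize T M • b X
      + Matrix.toEuclideanCLM (𝕜 := ℝ) (σ X).transpose (brownianIncrement W T M n ω)
      + compensatedIntegral N ν (gridPoint T M n) (gridPoint T M (n + 1))
          (fun z ↦ Matrix.toEuclideanCLM (𝕜 := ℝ) (γ X) z) ω

/-- `(Y, Z, Ψ)` is a square-integrable solution of the backward scheme with driver `f` and
terminal value `g(X_M)` along the discrete process `X`, with `Z_M = 0` and `Ψ_M = 0`.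
Square-integrability makes all conditional expectations below genuine ones. -/
structure IsBackwardSolution {d : ℕ} {Ω : Type*} [mΩ : MeasurableSpace Ω] (P : Measure Ω)
    (T : ℝ) (M : ℕ) (F : Filtration ℝ mΩ) (W : ℝ → Ω → EuclideanSpace ℝ (Fin d))
    (N : Ω → Measure (ℝ × EuclideanSpace ℝ (Fin d))) (ν : Measure (EuclideanSpace ℝ (Fin d)))
    (f : ℝ → EuclideanSpace ℝ (Fin d) → ℝ → EuclideanSpace ℝ (Fin d) → ℝ → ℝ)
    (g : EuclideanSpace ℝ (Fin d) → ℝ) (X : ℕ → Ω → EuclideanSpace ℝ (Fin d))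
    (Y : ℕ → Ω → ℝ) (Z : ℕ → Ω → EuclideanSpace ℝ (Fin d)) (Ψ : ℕ → Ω → ℝ) : Prop where
  memLp_Y : ∀ n ≤ M, MemLp (Y n) 2 P
  memLp_Z : ∀ n ≤ M, MemLp (Z n) 2 P
  memLp_Ψ : ∀ n ≤ M, MemLp (Ψ n) 2 P
  terminal_Y : Y M =ᵐ[P] fun ω ↦ g (X M ω)
  terminal_Z : Z M =ᵐ[P] 0
  terminal_Ψ : Ψ M =ᵐ[P] 0
  Z_eq : ∀ n < M, Z n =ᵐ[P] fun ω ↦ (1 / stepSize T M) •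
    (P[fun ω' ↦ Y (n + 1) ω' • brownianIncrement W T M n ω' | F (gridPoint T M n)]) ω
  Ψ_eq : ∀ n < M, Ψ n =ᵐ[P] fun ω ↦ (1 / stepSize T M) *
    (P[fun ω' ↦ Y (n + 1) ω' * compensatedJumpIncrement N ν T M n ω' | F (gridPoint T M n)]) ω
  Y_eq : ∀ n < M, Y n =ᵐ[P] fun ω ↦ (P[Y (n + 1) | F (gridPoint T M n)]) ω
    + f (gridPoint T M n) (X n ω) (Y n ω) (Z n ω) (Ψ n ω) * stepSize T M

end

/-! The scheme is Markov: up to null sets `X (n + 1) = Φ (X n, ξ n)`, where `Φ` is `eulerStep` and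
the noise increment `ξ n` is independent of the past. If `Y (n + 1) = u (X (n + 1))`, each
conditional expectation in the backward scheme has the form `E[u (Φ (X n, ξ n)) • k (ξ n) | F n]`
with `k` a coordinate of the noise or the constant 1. Freezing `X n` turns it into `∫ u (Φ (X n, y))
• k y` against the law of `ξ n`, a deterministic function of `X n` (`condExp_eulerScheme_succ`). The
implicit equation for `Y n` is then solved pointwise by Banach's fixed point theorem, because `K_f
Δt < 1`, and its solution is Lipschitz in the data (`exists_lipschitzWith_implicit_step`).

The class of measurable functions of linear growth contains `g` and is stable under both operations,
so `exists_backward_seq` iterates the step. Linear growth gives square-integrability once `X n` is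
in L². This rests on the second moment of the noise, whose jump part comes from the second moment
formula for Poisson random measures. -/

/-! ### Moments of the Poisson distribution. -/

/-- The factor `k` cancels against `k!`, which shifts the weights by one. Taking `φ = 1` and `φ k =
k` yields the first two moments. -/
lemma lintegral_natCast_mul_poissonMeasure (r : ℝ≥0) (φ : ℕ → ℝ≥0∞) :
    ∫⁻ k, (k : ℝ≥0∞) * φ k ∂(poissonMeasure r) = r * ∫⁻ k, φ (k + 1) ∂(poissonMeasure r) := by
  have hw : ∀ k : ℕ, ENNReal.ofReal (Real.exp (-r) * r ^ (k + 1) / (k + 1).factorial) *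
      ((k + 1 : ℕ) : ℝ≥0∞) = r * ENNReal.ofReal (Real.exp (-r) * r ^ k / k.factorial) := by
    intro k
    rw [← ENNReal.ofReal_natCast, ← ENNReal.ofReal_coe_nnreal (p := r),
      ← ENNReal.ofReal_mul (by positivity), ← ENNReal.ofReal_mul (by positivity)]
    congr 1
    rw [Nat.factorial_succ]
    push_cast
    field_simp
    ring
  simp only [poissonMeasure, lintegral_sum_measure, lintegral_smul_measure, lintegral_dirac,
    smul_eq_mul]
  rw [tsum_eq_zero_add' ENNReal.summable, ← ENNReal.tsum_mul_left]
  simp only [Nat.cast_zero, zero_mul, mul_zero, zero_add]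
  refine tsum_congr fun k ↦ ?_
  rw [← mul_assoc, hw, mul_assoc]

lemma lintegral_natCast_poissonMeasure (r : ℝ≥0) :
    ∫⁻ k, (k : ℝ≥0∞) ∂(poissonMeasure r) = r := by
  simpa using lintegral_natCast_mul_poissonMeasure r (fun _ ↦ 1)

lemma lintegral_natCast_sq_poissonMeasure (r : ℝ≥0) :
    ∫⁻ k, (k : ℝ≥0∞) * k ∂(poissonMeasure r) = r + r * r := by
  rw [lintegral_natCast_mul_poissonMeasure r (fun k ↦ (k : ℝ≥0∞))]
  simp only [Nat.cast_add, Nat.cast_one]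
  rw [lintegral_add_left (by fun_prop), lintegral_natCast_poissonMeasure]
  simp [mul_add, add_comm]

/-! ### Moment formulas for Poisson random measures. -/

namespace IsPoissonRandomMeasure

variable {Ω S : Type*} [MeasurableSpace Ω] [MeasurableSpace S] {N : Ω → Measure S}
  {μ : Measure S} {P : Measure Ω}

lemma measurable_apply (h : IsPoissonRandomMeasure N μ P) {A : Set S} (hA : MeasurableSet A) :
    Measurable fun ω ↦ N ω A :=
  (Measure.measurable_coe hA).comp h.measurable

lemma lintegral_comp_apply (h : IsPoissonRandomMeasure N μ P) [IsFiniteMeasure μ] {A : Set S}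
    (hA : MeasurableSet A) {φ : ℝ≥0∞ → ℝ≥0∞} (hφ : Measurable φ) :
    ∫⁻ ω, φ (N ω A) ∂P = ∫⁻ k, φ (k : ℕ) ∂(poissonMeasure (μ A).toNNReal) := by
  rw [(h.law A hA (measure_lt_top μ A)).lintegral_comp hφ.aemeasurable,
    lintegral_map hφ .of_discrete]

lemma lintegral_apply (h : IsPoissonRandomMeasure N μ P) [IsFiniteMeasure μ] {A : Set S}
    (hA : MeasurableSet A) : ∫⁻ ω, N ω A ∂P = μ A := by
  rw [h.lintegral_comp_apply hA (φ := fun x ↦ x) measurable_id, lintegral_natCast_poissonMeasure]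
  exact ENNReal.coe_toNNReal (measure_ne_top μ A)

lemma lintegral_apply_sq (h : IsPoissonRandomMeasure N μ P) [IsFiniteMeasure μ] {A : Set S}
    (hA : MeasurableSet A) : ∫⁻ ω, N ω A * N ω A ∂P = μ A + μ A * μ A := by
  rw [h.lintegral_comp_apply hA (φ := fun x ↦ x * x) (by fun_prop),
    lintegral_natCast_sq_poissonMeasure, ENNReal.coe_toNNReal (measure_ne_top μ A)]

lemma lintegral_apply_mul_of_disjoint (h : IsPoissonRandomMeasure N μ P) [IsFiniteMeasure μ]
    {A B : Set S} (hA : MeasurableSet A) (hB : MeasurableSet B) (hAB : Disjoint A B) :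
    ∫⁻ ω, N ω A * N ω B ∂P = μ A * μ B := by
  have hind : IndepFun (fun ω ↦ N ω A) (fun ω ↦ N ω B) P := by
    have := h.indep 2 ![A, B] (by simp [Fin.forall_fin_two, hA, hB]) (by
      intro i j hij
      fin_cases i <;> fin_cases j <;> simp_all [hAB.symm])
    simpa using this.indepFun (i := 0) (j := 1) (by simp)
  rw [← h.lintegral_apply hA, ← h.lintegral_apply hB]
  exact lintegral_mul_eq_lintegral_mul_lintegral_of_indepFun (h.measurable_apply hA)
    (h.measurable_apply hB) hind

/-- Splitting along `A ∩ B`, `A \ B`, `B \ A` makes all cross terms independent. The extra `μ (A ∩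
B)` is the variance of the common part. -/
lemma lintegral_apply_mul (h : IsPoissonRandomMeasure N μ P) [IsFiniteMeasure μ]
    {A B : Set S} (hA : MeasurableSet A) (hB : MeasurableSet B) :
    ∫⁻ ω, N ω A * N ω B ∂P = μ (A ∩ B) + μ A * μ B := by
  have hI := hA.inter hB
  have hA' := hA.diff hB
  have hB' := hB.diff hA
  have mI := h.measurable_apply hI
  have mA := h.measurable_apply hA'
  have mB := h.measurable_apply hB'
  have dA : ∀ m : Measure S, m A = m (A ∩ B) + m (A \ B) := fun m ↦
    (measure_inter_add_sdiff A hB).symm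
  have dB : ∀ m : Measure S, m B = m (A ∩ B) + m (B \ A) := fun m ↦ by
    rw [inter_comm, measure_inter_add_sdiff B hA]
  have hexp : ∀ ω, N ω A * N ω B = (N ω (A ∩ B) * N ω (A ∩ B) + N ω (A ∩ B) * N ω (B \ A)) +
      (N ω (A \ B) * N ω (A ∩ B) + N ω (A \ B) * N ω (B \ A)) := fun ω ↦ by
    rw [dA, dB]; ring
  simp_rw [hexp]
  rw [lintegral_add_left (by fun_prop), lintegral_add_left (by fun_prop),
    lintegral_add_left (by fun_prop), h.lintegral_apply_sq hI,
    h.lintegral_apply_mul_of_disjoint hI hB' (disjoint_sdiff_right.mono_left inter_subset_left),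
    h.lintegral_apply_mul_of_disjoint hA' hI (disjoint_sdiff_left.mono_right inter_subset_right),
    h.lintegral_apply_mul_of_disjoint hA' hB' (disjoint_sdiff_left.mono_right sdiff_subset),
    dA μ, dB μ]
  ring

/-- Campbell's formula. -/
lemma lintegral_lintegral (h : IsPoissonRandomMeasure N μ P) [IsFiniteMeasure μ]
    {k : S → ℝ≥0∞} (hk : Measurable k) : ∫⁻ ω, ∫⁻ p, k p ∂(N ω) ∂P = ∫⁻ p, k p ∂μ := by
  have hb : P.bind N = μ := by
    ext A hA
    rw [Measure.bind_apply hA h.measurable.aemeasurable, h.lintegral_apply hA]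
  rw [← Measure.lintegral_bind h.measurable.aemeasurable hk.aemeasurable, hb]

/-- For fixed `B`, `A ↦ E[N(B) N(A)]` is a measure, namely the mean of `N` under `P` weighted by
`N(B)`. It is identified on sets, after which any `k` can be integrated against it. -/
lemma lintegral_lintegral_mul_apply (h : IsPoissonRandomMeasure N μ P) [IsFiniteMeasure μ]
    {k : S → ℝ≥0∞} (hk : Measurable k) {B : Set S} (hB : MeasurableSet B) :
    ∫⁻ ω, N ω B * ∫⁻ p, k p ∂(N ω) ∂P = ∫⁻ p in B, k p ∂μ + μ B * ∫⁻ p, k p ∂μ := by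
  have hNB := h.measurable_apply hB
  have hb : (P.withDensity fun ω ↦ N ω B).bind N = μ.restrict B + μ B • μ := by
    ext A hA
    rw [Measure.bind_apply hA h.measurable.aemeasurable,
      lintegral_withDensity_eq_lintegral_mul _ hNB (h.measurable_apply hA)]
    simp only [Pi.mul_apply, Measure.coe_add, Pi.add_apply, Measure.restrict_apply hA,
      Measure.smul_apply, smul_eq_mul]
    rw [h.lintegral_apply_mul hB hA, inter_comm]
  have h1 := Measure.lintegral_bind (m := P.withDensity fun ω ↦ N ω B)
    h.measurable.aemeasurable (hk.aemeasurable)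
  rw [hb, lintegral_add_measure, lintegral_smul_measure, smul_eq_mul,
    lintegral_withDensity_eq_lintegral_mul _ hNB
      (g := fun ω ↦ ∫⁻ p, k p ∂(N ω))
      ((Measure.measurable_lintegral hk).comp h.measurable)] at h1
  exact h1.symm

/-- The second moment formula for Poisson random measures. -/
lemma lintegral_lintegral_mul (h : IsPoissonRandomMeasure N μ P) [IsFiniteMeasure μ]
    {k l : S → ℝ≥0∞} (hk : Measurable k) (hl : Measurable l) :
    ∫⁻ ω, (∫⁻ p, k p ∂(N ω)) * ∫⁻ p, l p ∂(N ω) ∂P =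
      ∫⁻ p, k p * l p ∂μ + (∫⁻ p, k p ∂μ) * ∫⁻ p, l p ∂μ := by
  have hNk : Measurable fun ω ↦ ∫⁻ p, k p ∂(N ω) :=
    (Measure.measurable_lintegral hk).comp h.measurable
  -- The same weighting device in the other factor: the weight is now the integral of `k`, and the
  -- set case is the preceding lemma.
  have hb : (P.withDensity fun ω ↦ ∫⁻ p, k p ∂(N ω)).bind N =
      μ.withDensity k + (∫⁻ p, k p ∂μ) • μ := by
    ext A hA
    rw [Measure.bind_apply hA h.measurable.aemeasurable,
      lintegral_withDensity_eq_lintegral_mul _ hNk (h.measurable_apply hA)]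
    simp only [Pi.mul_apply, Measure.coe_add, Pi.add_apply, withDensity_apply _ hA,
      Measure.smul_apply, smul_eq_mul]
    simp_rw [mul_comm _ (N _ A)]
    rw [h.lintegral_lintegral_mul_apply hk hA, mul_comm (μ A)]
  have h1 := Measure.lintegral_bind (m := P.withDensity fun ω ↦ ∫⁻ p, k p ∂(N ω))
    h.measurable.aemeasurable (hl.aemeasurable)
  rw [hb, lintegral_add_measure, lintegral_smul_measure, smul_eq_mul,
    lintegral_withDensity_eq_lintegral_mul _ hk hl,
    lintegral_withDensity_eq_lintegral_mul _ hNk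
      (g := fun ω ↦ ∫⁻ p, l p ∂(N ω))
      ((Measure.measurable_lintegral hl).comp h.measurable)] at h1
  exact h1.symm

end IsPoissonRandomMeasure

/-! ### Conditional expectation by freezing the known variable. -/

section Freezing

variable {Ω E G H : Type*} {m : MeasurableSpace Ω} [mΩ : MeasurableSpace Ω] [MeasurableSpace E]
  [MeasurableSpace G] [NormedAddCommGroup H] [NormedSpace ℝ H]
  {P : Measure Ω} [IsProbabilityMeasure P]

/-- Independence makes the joint law a product, so Fubini on `s ×ˢ univ` is exactly the averaging
property over `ι ⁻¹' s`. -/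
lemma condExp_comap_comp_of_indepFun [CompleteSpace H] {A : Type*} [mA : MeasurableSpace A]
    {ι : Ω → A} (hι : Measurable ι) {ξ : Ω → G} (hξ : Measurable ξ) (hind : IndepFun ι ξ P)
    {ψ : A × G → H} (hψ : StronglyMeasurable ψ) (hint : Integrable (fun ω ↦ ψ (ι ω, ξ ω)) P) :
    P[fun ω ↦ ψ (ι ω, ξ ω) | mA.comap ι] =ᵐ[P] fun ω ↦ ∫ y, ψ (ι ω, y) ∂(P.map ξ) := by
  have hmap := (indepFun_iff_map_prod_eq_prod_map_map hι.aemeasurable hξ.aemeasurable).1 hind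
  have := Measure.isProbabilityMeasure_map (μ := P) hξ.aemeasurable
  have := Measure.isProbabilityMeasure_map (μ := P) hι.aemeasurable
  have hprod : Integrable ψ ((P.map ι).prod (P.map ξ)) := by
    rw [← hmap]
    exact (integrable_map_measure hψ.aestronglyMeasurable (hι.prodMk hξ).aemeasurable).2 hint
  have hsm : StronglyMeasurable fun a ↦ ∫ y, ψ (a, y) ∂(P.map ξ) :=
    hψ.integral_prod_right'
  have hleft : Integrable (fun a ↦ ∫ y, ψ (a, y) ∂(P.map ξ)) (P.map ι) :=
    hprod.integral_prod_left
  symm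
  refine ae_eq_condExp_of_forall_setIntegral_eq hι.comap_le hint ?_ ?_ ?_
  · intro s _ _
    exact ((integrable_map_measure hsm.aestronglyMeasurable hι.aemeasurable).1 hleft).integrableOn
  · rintro _ ⟨s, hs, rfl⟩ -
    rw [← setIntegral_map hs hsm.aestronglyMeasurable hι.aemeasurable]
    have h1 := setIntegral_map (μ := P) (hs.prod MeasurableSet.univ) (f := ψ)
      (g := fun ω ↦ (ι ω, ξ ω)) hψ.aestronglyMeasurable (hι.prodMk hξ).aemeasurable
    rw [hmap, setIntegral_prod _ hprod.integrableOn] at h1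
    simpa [mk_preimage_prod] using h1
  · exact (hsm.comp_measurable (comap_measurable ι)).aestronglyMeasurable

/-- Conditioning a function of an `m`-measurable and an independent variable on `m`. -/
lemma condExp_comp_of_indep [CompleteSpace H] (hm : m ≤ mΩ)
    {X : Ω → E} (hX : Measurable[m] X) {ξ : Ω → G} (hξ : Measurable ξ)
    (hind : Indep m (MeasurableSpace.comap ξ inferInstance) P)
    {φ : E × G → H} (hφ : StronglyMeasurable φ) (hint : Integrable (fun ω ↦ φ (X ω, ξ ω)) P) :
    P[fun ω ↦ φ (X ω, ξ ω) | m] =ᵐ[P] fun ω ↦ ∫ y, φ (X ω, y) ∂(P.map ξ) := by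
  -- The identity, seen as a map from `(Ω, mΩ)` to `(Ω, m)`, generates `m`; thus an arbitrary
  -- sub-σ-algebra is of the form `comap`.
  have hid : @IndepFun Ω Ω G mΩ m _ id ξ P := by
    refine (@IndepFun_iff_Indep Ω Ω G mΩ m _ id ξ P).2 ?_
    rwa [MeasurableSpace.comap_id]
  have := condExp_comap_comp_of_indepFun (mA := m) (measurable_id'' hm) hξ hid
    (ψ := fun p ↦ φ (X p.1, p.2)) (hφ.comp_measurable (by
      exact (hX.comp measurable_fst).prodMk measurable_snd)) hint
  rwa [MeasurableSpace.comap_id] at this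

end Freezing

/-! ### Functions of linear growth. -/

section LinearGrowth

variable {E F G : Type*} [NormedAddCommGroup E] [NormedAddCommGroup F] [NormedAddCommGroup G]

/-- `φ` grows at most linearly. -/
def LinearGrowth (φ : E → F) : Prop :=
  ∃ C : ℝ, 0 ≤ C ∧ ∀ x, ‖φ x‖ ≤ C * (1 + ‖x‖)

lemma LipschitzWith.linearGrowth {K : ℝ≥0} {φ : E → F} (h : LipschitzWith K φ) :
    LinearGrowth φ := by
  refine ⟨‖φ 0‖ + K, by positivity, fun x ↦ ?_⟩
  have h1 := h.dist_le_mul x 0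
  rw [dist_eq_norm, dist_zero_right] at h1
  have h2 := norm_le_norm_add_norm_sub' (φ x) (φ 0)
  nlinarith [norm_nonneg (φ 0), norm_nonneg x, K.2, mul_nonneg (norm_nonneg (φ 0)) (norm_nonneg x)]

lemma LinearGrowth.id : LinearGrowth (id : E → E) :=
  ⟨1, zero_le_one, fun x ↦ by simp⟩

lemma LinearGrowth.zero : LinearGrowth (0 : E → F) :=
  ⟨0, le_rfl, fun x ↦ by simp⟩

lemma LinearGrowth.prodMk {φ : E → F} {ψ : E → G} (hφ : LinearGrowth φ) (hψ : LinearGrowth ψ) :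
    LinearGrowth fun x ↦ (φ x, ψ x) := by
  obtain ⟨C, hC, hφ⟩ := hφ
  obtain ⟨D, hD, hψ⟩ := hψ
  refine ⟨C + D, by positivity, fun x ↦ ?_⟩
  have := norm_nonneg x
  refine max_le ((hφ x).trans ?_) ((hψ x).trans ?_) <;> gcongr <;> linarith

lemma LinearGrowth.comp {φ : F → G} {ψ : E → F} (hφ : LinearGrowth φ) (hψ : LinearGrowth ψ) :
    LinearGrowth fun x ↦ φ (ψ x) := by
  obtain ⟨C, hC, hφ⟩ := hφ
  obtain ⟨D, hD, hψ⟩ := hψ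
  refine ⟨C * (1 + D), by positivity, fun x ↦ (hφ _).trans ?_⟩
  rw [mul_assoc]
  gcongr
  nlinarith [hψ x, norm_nonneg x]

end LinearGrowth

/-! ### The implicit equation for `Y`. -/

section ImplicitStep

variable {E : Type*} [NormedAddCommGroup E]

/-- The implicit equation `y = a + f(x, y, z, u) δ` has a solution which depends in a Lipschitz
way on `(x, a, z, u)`. -/
lemma exists_lipschitzWith_implicit_step {f : E → ℝ → E → ℝ → ℝ} {K δ : ℝ} (hK : 0 < K)
    (hδ : 0 ≤ δ) (hδK : δ < 1 / K)
    (hf : ∀ x x' y y' z z' u u',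
      |f x y z u - f x' y' z' u'| ≤ K * (‖x - x'‖ + |y - y'| + ‖z - z'‖ + |u - u'|)) :
    ∃ (C : ℝ≥0) (h : E × ℝ × E × ℝ → ℝ), LipschitzWith C h ∧
      ∀ x a z u, h (x, a, z, u) = a + f x (h (x, a, z, u)) z u * δ := by
  have hKδ : K * δ < 1 := by rw [lt_div_iff₀ hK] at hδK; linarith
  have hex : ∀ p : E × ℝ × E × ℝ, ∃ y : ℝ, y = p.2.1 + f p.1 y p.2.2.1 p.2.2.2 * δ := by
    rintro ⟨x, a, z, u⟩
    have hc : ContractingWith (Real.toNNReal (K * δ)) (fun y ↦ a + f x y z u * δ) := by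
      refine ⟨by simpa [Real.toNNReal_lt_one] using hKδ, LipschitzWith.of_dist_le_mul fun y y' ↦ ?_⟩
      rw [Real.coe_toNNReal _ (by positivity), Real.dist_eq, Real.dist_eq, add_sub_add_left_eq_sub,
        ← sub_mul, abs_mul, abs_of_nonneg hδ]
      have := hf x x y y' z z u u
      simp only [sub_self, norm_zero, abs_zero, zero_add, add_zero] at this
      nlinarith
    exact ⟨hc.fixedPoint, hc.fixedPoint_isFixedPt.symm⟩
  choose h hh using hex
  -- Subtracting two equations and absorbing `Kδ |y - y'|` on the left leaves the factor `1 - Kδ`.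
  -- On the right, `|a - a'|` contributes 1 and `x, z, u` contribute `Kδ` each, all distances being
  -- at most the sup distance. Only the equation is used, so the choice of `h` does no harm.
  refine ⟨Real.toNNReal ((1 + 3 * (K * δ)) / (1 - K * δ)), h, LipschitzWith.of_dist_le_mul ?_,
    fun x a z u ↦ hh (x, a, z, u)⟩
  rintro ⟨x, a, z, u⟩ ⟨x', a', z', u'⟩
  have h1 : 0 < 1 - K * δ := by linarith
  have h0 : 0 ≤ K * δ := by positivity
  rw [Real.coe_toNNReal _ (by positivity), div_mul_eq_mul_div, le_div_iff₀ h1]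
  have e := hh (x, a, z, u)
  have e' := hh (x', a', z', u')
  simp only at e e'
  set y := h (x, a, z, u)
  set y' := h (x', a', z', u')
  set D := dist (x, a, z, u) (x', a', z', u') with hD
  have hmax : D = max ‖x - x'‖ (max |a - a'| (max ‖z - z'‖ |u - u'|)) := by
    simp [hD, dist_eq_norm]
  have d1 : ‖x - x'‖ ≤ D := by simp [hmax]
  have d2 : |a - a'| ≤ D := by simp [hmax]
  have d3 : ‖z - z'‖ ≤ D := by simp [hmax]
  have d4 : |u - u'| ≤ D := by simp [hmax]
  have key : |y - y'| ≤ |a - a'| + |f x y z u - f x' y' z' u'| * δ := by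
    have : y - y' = (a - a') + (f x y z u - f x' y' z' u') * δ := by
      rw [sub_mul]; linarith
    calc |y - y'| = |(a - a') + (f x y z u - f x' y' z' u') * δ| := by rw [this]
      _ ≤ _ := (abs_add_le _ _).trans (by rw [abs_mul, abs_of_nonneg hδ])
  have h2 := mul_le_mul_of_nonneg_right (hf x x' y y' z z' u u') hδ
  rw [Real.dist_eq]
  have h3 : K * δ * (‖x - x'‖ + ‖z - z'‖ + |u - u'|) ≤ K * δ * (3 * D) := by
    gcongr; linarith
  nlinarith

end ImplicitStep

/-! ### The time grid. -/

section GridPoint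

variable {T : ℝ} {M n : ℕ}

lemma stepSize_pos (hT : 0 < T) (hM : 0 < M) : 0 < stepSize T M := by
  unfold stepSize; positivity

lemma gridPoint_succ_sub : gridPoint T M (n + 1) - gridPoint T M n = stepSize T M := by
  unfold gridPoint; push_cast; ring

lemma gridPoint_nonneg (hT : 0 < T) (hM : 0 < M) : 0 ≤ gridPoint T M n :=
  mul_nonneg n.cast_nonneg (stepSize_pos hT hM).le

lemma gridPoint_le_succ (hT : 0 < T) (hM : 0 < M) :
    gridPoint T M n ≤ gridPoint T M (n + 1) := by
  have h := gridPoint_succ_sub (T := T) (M := M) (n := n)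
  linarith [stepSize_pos hT hM]

lemma gridPoint_le (hT : 0 < T) (hM : 0 < M) (hn : n ≤ M) : gridPoint T M n ≤ T := by
  have h1 : (n : ℝ) ≤ M := by exact_mod_cast hn
  have h2 : (0 : ℝ) < M := by exact_mod_cast hM
  calc gridPoint T M n ≤ M * stepSize T M :=
        mul_le_mul_of_nonneg_right h1 (stepSize_pos hT hM).le
    _ = T := by unfold stepSize; field_simp

lemma gridPoint_mem_Icc (hT : 0 < T) (hM : 0 < M) (hn : n ≤ M) : gridPoint T M n ∈ Icc 0 T :=
  ⟨gridPoint_nonneg hT hM, gridPoint_le hT hM hn⟩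

end GridPoint

/-! ### Integrability against a Poisson random measure. -/

namespace IsPoissonRandomMeasure

variable {Ω S : Type*} [MeasurableSpace Ω] [MeasurableSpace S] {N : Ω → Measure S}
  {μ : Measure S} {P : Measure Ω}

/-- Integrals of square-integrable functions against a Poisson random measure with finite
intensity are square-integrable. -/
lemma lintegral_sq_lintegral_lt_top (h : IsPoissonRandomMeasure N μ P) [IsFiniteMeasure μ]
    {G : Type*} [NormedAddCommGroup G] [MeasurableSpace G] [OpensMeasurableSpace G]
    {k : S → G} (hk : Measurable k) (hk2 : MemLp k 2 μ) :
    ∫⁻ ω, (∫⁻ p, ‖k p‖ₑ ∂(N ω)) ^ 2 ∂P < ∞ := by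
  simp_rw [sq]
  rw [h.lintegral_lintegral_mul hk.enorm hk.enorm]
  have h1 : ∫⁻ p, ‖k p‖ₑ ∂μ < ∞ := (hk2.integrable (by norm_num)).2
  have h2 : ∫⁻ p, ‖k p‖ₑ * ‖k p‖ₑ ∂μ < ∞ := by
    have := lintegral_rpow_enorm_lt_top_of_eLpNorm_lt_top (by norm_num) (by norm_num) hk2.2
    simpa [← sq] using this
  exact ENNReal.add_lt_top.2 ⟨h2, ENNReal.mul_lt_top h1 h1⟩

lemma ae_integrable (h : IsPoissonRandomMeasure N μ P) [IsFiniteMeasure μ]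
    {G : Type*} [NormedAddCommGroup G] [MeasurableSpace G] [OpensMeasurableSpace G]
    [SecondCountableTopology G] {k : S → G} (hk : Measurable k) (hk1 : Integrable k μ) :
    ∀ᵐ ω ∂P, Integrable k (N ω) := by
  have h1 : ∫⁻ ω, ∫⁻ p, ‖k p‖ₑ ∂(N ω) ∂P ≠ ∞ := by
    rw [h.lintegral_lintegral hk.enorm]
    exact hk1.2.ne
  filter_upwards [ae_lt_top ((Measure.measurable_lintegral hk.enorm).comp h.measurable) h1]
    with ω hω
  exact ⟨hk.stronglyMeasurable.aestronglyMeasurable, hω⟩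

end IsPoissonRandomMeasure

/-! ### Sums of jumps as exactly measurable random vectors. -/

section JumpSum

variable {d : ℕ} {Ω : Type*}

/-- The sum of the jumps in a set `B`, as a random vector which is exactly measurable. -/
noncomputable def jumpSum (N : Ω → Measure (ℝ × EuclideanSpace ℝ (Fin d)))
    (B : Set (ℝ × EuclideanSpace ℝ (Fin d))) (ω : Ω) : EuclideanSpace ℝ (Fin d) :=
  WithLp.toLp 2 fun i ↦ (∫⁻ p in B, ENNReal.ofReal (p.2 i) ∂(N ω)).toReal -
    (∫⁻ p in B, ENNReal.ofReal (-p.2 i) ∂(N ω)).toReal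

lemma jumpSum_eq_integral {N : Ω → Measure (ℝ × EuclideanSpace ℝ (Fin d))}
    {B : Set (ℝ × EuclideanSpace ℝ (Fin d))} {ω : Ω}
    (h : Integrable (fun p ↦ p.2) ((N ω).restrict B)) :
    jumpSum N B ω = ∫ p in B, p.2 ∂(N ω) := by
  ext i
  have h1 := (EuclideanSpace.proj (𝕜 := ℝ) i).integral_comp_comm h
  have h2 := integral_eq_lintegral_pos_part_sub_lintegral_neg_part
    ((EuclideanSpace.proj (𝕜 := ℝ) i).integrable_comp h)
  simp only [PiLp.proj_apply] at h1 h2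
  rw [← h1, h2]
  rfl

lemma measurable_restrict_of_forall_subset {S : Type*} [MeasurableSpace S] [MeasurableSpace Ω]
    {N : Ω → Measure S} {B : Set S} (hB : MeasurableSet B)
    (h : ∀ A, MeasurableSet A → A ⊆ B → Measurable fun ω ↦ N ω A) :
    Measurable fun ω ↦ (N ω).restrict B := by
  refine Measure.measurable_of_measurable_coe _ fun A hA ↦ ?_
  simp_rw [Measure.restrict_apply hA]
  exact h _ (hA.inter hB) inter_subset_right

/-- Lebesgue integrals of positive and negative parts need neither integrability nor a complete
σ-algebra, so this applies both to `F` and to `futureNoise`. -/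
lemma measurable_jumpSum [MeasurableSpace Ω] {N : Ω → Measure (ℝ × EuclideanSpace ℝ (Fin d))}
    {B : Set (ℝ × EuclideanSpace ℝ (Fin d))} (hB : MeasurableSet B)
    (h : ∀ A, MeasurableSet A → A ⊆ B → Measurable fun ω ↦ N ω A) :
    Measurable (jumpSum N B) := by
  have hN := measurable_restrict_of_forall_subset hB h
  refine (WithLp.measurable_toLp 2 _).comp (measurable_pi_lambda _ fun i ↦ ?_)
  have h1 : Measurable fun p : ℝ × EuclideanSpace ℝ (Fin d) ↦ ENNReal.ofReal (p.2 i) := by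
    fun_prop
  have h2 : Measurable fun p : ℝ × EuclideanSpace ℝ (Fin d) ↦ ENNReal.ofReal (-p.2 i) := by
    fun_prop
  exact (((Measure.measurable_lintegral h1).comp hN).ennreal_toReal).sub
    (((Measure.measurable_lintegral h2).comp hN).ennreal_toReal)

end JumpSum

lemma IsSquareIntegrableLevyMeasure.memLp_id {d : ℕ} {ν : Measure (EuclideanSpace ℝ (Fin d))}
    (hν : IsSquareIntegrableLevyMeasure ν) : MemLp (fun z ↦ z) 2 ν := by
  refine ⟨by fun_prop, ?_⟩
  rw [eLpNorm_lt_top_iff_lintegral_rpow_enorm_lt_top (by norm_num) (by norm_num)]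
  have hS : MeasurableSet {z : EuclideanSpace ℝ (Fin d) | 1 ≤ ‖z‖} :=
    measurableSet_le measurable_const measurable_norm
  simp only [ENNReal.toReal_ofNat, ENNReal.rpow_ofNat]
  rw [← lintegral_add_compl _ hS]
  refine ENNReal.add_lt_top.2 ⟨hν.large_jumps, lt_of_le_of_lt ?_ hν.small_jumps⟩
  refine le_trans (lintegral_mono_ae ?_) (setLIntegral_le_lintegral _ _)
  filter_upwards [ae_restrict_mem hS.compl] with z hz
  refine le_min ?_ le_rfl
  have : ‖z‖ₑ ≤ 1 := by
    rw [← ofReal_norm, ENNReal.ofReal_le_one]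
    have hz' : ¬ 1 ≤ ‖z‖ := hz
    exact (not_le.1 hz').le
  exact pow_le_one' this 2

/-! ### Noise increments: measurability, independence, second moments. -/

section Noise

variable {d : ℕ} {Ω : Type*}

/-- The Brownian increment, the compensated sum of the jumps and the compensated number of jumps
over a time step. -/
noncomputable def noiseIncrement (W : ℝ → Ω → EuclideanSpace ℝ (Fin d))
    (N : Ω → Measure (ℝ × EuclideanSpace ℝ (Fin d))) (ν : Measure (EuclideanSpace ℝ (Fin d)))
    (T : ℝ) (M n : ℕ) (ω : Ω) : EuclideanSpace ℝ (Fin d) × EuclideanSpace ℝ (Fin d) × ℝ :=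
  (brownianIncrement W T M n ω,
    jumpSum N (Ioc (gridPoint T M n) (gridPoint T M (n + 1)) ×ˢ univ) ω -
      stepSize T M • ∫ z, z ∂ν,
    compensatedJumpIncrement N ν T M n ω)

lemma compensatedJumpIncrement_eq {N : Ω → Measure (ℝ × EuclideanSpace ℝ (Fin d))}
    {ν : Measure (EuclideanSpace ℝ (Fin d))} {T : ℝ} {M n : ℕ} (ω : Ω) :
    compensatedJumpIncrement N ν T M n ω =
      (N ω (Ioc (gridPoint T M n) (gridPoint T M (n + 1)) ×ˢ univ)).toReal -
        stepSize T M * ν.real univ := by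
  simp [compensatedJumpIncrement, compensatedIntegral, gridPoint_succ_sub, Measure.real]

lemma measurable_noiseIncrement [MeasurableSpace Ω] {W : ℝ → Ω → EuclideanSpace ℝ (Fin d)}
    {N : Ω → Measure (ℝ × EuclideanSpace ℝ (Fin d))} {ν : Measure (EuclideanSpace ℝ (Fin d))}
    {T : ℝ} {M n : ℕ}
    (hW : Measurable (brownianIncrement W T M n))
    (hN : ∀ A, MeasurableSet A →
      A ⊆ Ioc (gridPoint T M n) (gridPoint T M (n + 1)) ×ˢ univ → Measurable fun ω ↦ N ω A) :
    Measurable (noiseIncrement W N ν T M n) := by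
  have hB : MeasurableSet (Ioc (gridPoint T M n) (gridPoint T M (n + 1)) ×ˢ
    (univ : Set (EuclideanSpace ℝ (Fin d)))) := measurableSet_Ioc.prod .univ
  refine hW.prodMk (((measurable_jumpSum hB hN).sub_const _).prodMk ?_)
  simp_rw [funext compensatedJumpIncrement_eq]
  exact ((hN _ hB subset_rfl).ennreal_toReal).sub_const _

lemma measurable_noiseIncrement_futureNoise {W : ℝ → Ω → EuclideanSpace ℝ (Fin d)}
    {N : Ω → Measure (ℝ × EuclideanSpace ℝ (Fin d))} {ν : Measure (EuclideanSpace ℝ (Fin d))}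
    {T : ℝ} {M n : ℕ} (hT : 0 < T) (hM : 0 < M) (hn : n < M) :
    Measurable[futureNoise W N T (gridPoint T M n)] (noiseIncrement W N ν T M n) := by
  have h1 : gridPoint T M (n + 1) ≤ T := gridPoint_le hT hM hn
  refine @measurable_noiseIncrement d Ω (futureNoise W N T (gridPoint T M n)) W N ν T M n ?_ ?_
  · refine Measurable.mono (comap_measurable _) ?_ le_rfl
    refine le_sup_of_le_left ?_
    exact le_iSup₂_of_le (gridPoint T M (n + 1)) ⟨gridPoint_le_succ hT hM, h1⟩ le_rfl
  · intro A hA hAB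
    refine Measurable.mono (comap_measurable _) ?_ le_rfl
    refine le_sup_of_le_right ?_
    exact le_iSup₂_of_le A ⟨hA, hAB.trans (prod_mono (Ioc_subset_Ioc_right h1) subset_rfl)⟩ le_rfl

variable [mΩ : MeasurableSpace Ω] {P : Measure Ω} {T : ℝ}
  {F : Filtration ℝ mΩ} {W : ℝ → Ω → EuclideanSpace ℝ (Fin d)}
  {N : Ω → Measure (ℝ × EuclideanSpace ℝ (Fin d))} {ν : Measure (EuclideanSpace ℝ (Fin d))}
  {M n : ℕ}

namespace IsBrownianPoissonNoise

lemma measurable_noiseIncrement_filtration (h : IsBrownianPoissonNoise P T F W N ν)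
    (hT : 0 < T) (hM : 0 < M) (hn : n < M) :
    Measurable[F (gridPoint T M (n + 1))] (noiseIncrement W N ν T M n) := by
  refine @measurable_noiseIncrement d Ω (F (gridPoint T M (n + 1))) W N ν T M n ?_ ?_
  · exact (h.W_adapted _ (gridPoint_mem_Icc hT hM hn)).sub
      ((h.W_adapted _ (gridPoint_mem_Icc hT hM hn.le)).mono (F.mono (gridPoint_le_succ hT hM))
        le_rfl)
  · intro A hA hAB
    refine h.N_adapted _ (gridPoint_mem_Icc hT hM hn) A hA (hAB.trans (prod_mono ?_ subset_rfl))
    exact fun t ht ↦ ⟨(gridPoint_nonneg hT hM).trans ht.1.le, ht.2⟩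

lemma measurable_noiseIncrement_ambient (h : IsBrownianPoissonNoise P T F W N ν)
    (hT : 0 < T) (hM : 0 < M) (hn : n < M) : Measurable (noiseIncrement W N ν T M n) :=
  (h.measurable_noiseIncrement_filtration hT hM hn).mono (F.le _) le_rfl

lemma indep_noiseIncrement (h : IsBrownianPoissonNoise P T F W N ν)
    (hT : 0 < T) (hM : 0 < M) (hn : n < M) :
    Indep (F (gridPoint T M n))
      (MeasurableSpace.comap (noiseIncrement W N ν T M n) inferInstance) P :=
  indep_of_indep_of_le_right (h.indep _ (gridPoint_mem_Icc hT hM hn.le))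
    (measurable_noiseIncrement_futureNoise hT hM hn).comap_le

lemma memLp_brownianIncrement (h : IsBrownianPoissonNoise P T F W N ν)
    (hT : 0 < T) (hM : 0 < M) (hn : n < M) : MemLp (brownianIncrement W T M n) 2 P := by
  have hl := h.W_law _ _ (gridPoint_nonneg hT hM) (gridPoint_le_succ hT hM (n := n))
    (gridPoint_le hT hM hn)
  have h1 : MemLp id 2 (P.map (brownianIncrement W T M n)) := by
    unfold brownianIncrement
    rw [hl.map_eq, memLp_map_measure_iff (by fun_prop) (by fun_prop)]
    exact (IsGaussian.memLp_two_id (μ := stdGaussian (EuclideanSpace ℝ (Fin d)))).const_smul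
      (√(gridPoint T M (n + 1) - gridPoint T M n))
  exact (memLp_map_measure_iff (by fun_prop) hl.aemeasurable).1 h1

variable [IsFiniteMeasure ν]

lemma memLp_snd (hν : IsSquareIntegrableLevyMeasure ν) :
    MemLp (fun p : ℝ × EuclideanSpace ℝ (Fin d) ↦ p.2) 2
      ((volume.restrict (Icc 0 T)).prod ν) :=
  hν.memLp_id.comp_snd _

lemma ae_integrable_snd (h : IsBrownianPoissonNoise P T F W N ν)
    (hν : IsSquareIntegrableLevyMeasure ν) : ∀ᵐ ω ∂P, Integrable (fun p ↦ p.2) (N ω) :=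
  h.N_poisson.ae_integrable measurable_snd ((memLp_snd hν).integrable (by norm_num))

/-- The null set must not depend on `A`, since `A` will be the random matrix `γ (X n ω)`. It is the
set where `z` fails to be integrable against `N ω`; elsewhere every linear map commutes with the
integral. -/
lemma ae_compensatedIntegral_eq (h : IsBrownianPoissonNoise P T F W N ν)
    (hν : IsSquareIntegrableLevyMeasure ν) :
    ∀ᵐ ω ∂P, ∀ A : EuclideanSpace ℝ (Fin d) →L[ℝ] EuclideanSpace ℝ (Fin d),
      compensatedIntegral N ν (gridPoint T M n) (gridPoint T M (n + 1)) (fun z ↦ A z) ω =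
        A (noiseIncrement W N ν T M n ω).2.1 := by
  filter_upwards [h.ae_integrable_snd hν] with ω hω A
  have hν1 : Integrable (fun z ↦ z) ν := hν.memLp_id.integrable (by norm_num)
  have hr : Integrable (fun p ↦ p.2) ((N ω).restrict
    (Ioc (gridPoint T M n) (gridPoint T M (n + 1)) ×ˢ univ)) := hω.integrableOn
  rw [noiseIncrement, jumpSum_eq_integral hr, compensatedIntegral, gridPoint_succ_sub,
    A.integral_comp_comm hr, A.integral_comp_comm hν1, map_sub, map_smul]

lemma memLp_of_enorm_le_lintegral [IsFiniteMeasure P] (h : IsBrownianPoissonNoise P T F W N ν)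
    {G H : Type*} [NormedAddCommGroup G] [MeasurableSpace G] [OpensMeasurableSpace G]
    [NormedAddCommGroup H]
    {k : ℝ × EuclideanSpace ℝ (Fin d) → G} (hk : Measurable k)
    (hk2 : MemLp k 2 ((volume.restrict (Icc 0 T)).prod ν)) {Z : Ω → H}
    (hZ : AEStronglyMeasurable Z P) (hle : ∀ᵐ ω ∂P, ‖Z ω‖ₑ ≤ ∫⁻ p, ‖k p‖ₑ ∂(N ω)) :
    MemLp Z 2 P := by
  refine ⟨hZ, ?_⟩
  rw [eLpNorm_lt_top_iff_lintegral_rpow_enorm_lt_top (by norm_num) (by norm_num)]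
  simp only [ENNReal.toReal_ofNat, ENNReal.rpow_ofNat]
  refine lt_of_le_of_lt (lintegral_mono_ae ?_) (h.N_poisson.lintegral_sq_lintegral_lt_top hk hk2)
  filter_upwards [hle] with ω hω
  gcongr

lemma memLp_noiseIncrement [IsFiniteMeasure P] (h : IsBrownianPoissonNoise P T F W N ν)
    (hν : IsSquareIntegrableLevyMeasure ν) (hT : 0 < T) (hM : 0 < M) (hn : n < M) :
    MemLp (noiseIncrement W N ν T M n) 2 P := by
  have hB : MeasurableSet (Ioc (gridPoint T M n) (gridPoint T M (n + 1)) ×ˢ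
    (univ : Set (EuclideanSpace ℝ (Fin d)))) := measurableSet_Ioc.prod .univ
  have hN : ∀ A, MeasurableSet A →
      A ⊆ Ioc (gridPoint T M n) (gridPoint T M (n + 1)) ×ˢ univ → Measurable fun ω ↦ N ω A :=
    fun A hA _ ↦ h.N_poisson.measurable_apply hA
  have hJ : MemLp (jumpSum N (Ioc (gridPoint T M n) (gridPoint T M (n + 1)) ×ˢ univ)) 2 P := by
    refine h.memLp_of_enorm_le_lintegral measurable_snd (memLp_snd hν)
      (measurable_jumpSum hB hN).aestronglyMeasurable ?_
    filter_upwards [h.ae_integrable_snd hν] with ω hω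
    rw [jumpSum_eq_integral hω.integrableOn]
    exact (enorm_integral_le_lintegral_enorm _).trans (setLIntegral_le_lintegral _ _)
  have hK : MemLp (fun ω ↦ (N ω (Ioc (gridPoint T M n) (gridPoint T M (n + 1)) ×ˢ univ)).toReal)
      2 P := by
    refine h.memLp_of_enorm_le_lintegral (k := fun _ ↦ (1 : ℝ)) measurable_const (memLp_const 1)
      (hN _ hB subset_rfl).ennreal_toReal.aestronglyMeasurable (.of_forall fun ω ↦ ?_)
    rw [Real.enorm_of_nonneg ENNReal.toReal_nonneg]
    refine ENNReal.ofReal_toReal_le.trans ?_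
    simpa using measure_mono (subset_univ _)
  refine memLp_prod_iff.2 ⟨h.memLp_brownianIncrement hT hM hn,
    memLp_prod_iff.2 ⟨hJ.sub (memLp_const _), ?_⟩⟩
  simp only [noiseIncrement, compensatedJumpIncrement_eq]
  exact hK.sub (memLp_const _)

end IsBrownianPoissonNoise

end Noise

lemma MeasureTheory.MemLp.one_add_norm {Ω H : Type*} [MeasurableSpace Ω] [NormedAddCommGroup H]
    {P : Measure Ω} [IsFiniteMeasure P] {Z : Ω → H} (hZ : MemLp Z 2 P) :
    MemLp (fun ω ↦ 1 + ‖Z ω‖) 2 P := by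
  have h1 : MemLp (fun _ : Ω ↦ (1 : ℝ)) 2 P := memLp_const 1
  exact h1.add hZ.norm

/-- Weighted values after a step of a function of linear growth. -/
lemma LinearGrowth.exists_norm_step_smul_le {E S G : Type*} [NormedAddCommGroup E]
    [NormedAddCommGroup S] [NormedAddCommGroup G] [NormedSpace ℝ G] {Φ : E × S → E} {C : ℝ}
    {u : E → ℝ} {k : S → G} (hu : LinearGrowth u) (hC : 0 ≤ C)
    (hΦC : ∀ x y, ‖Φ (x, y)‖ ≤ C * ((1 + ‖x‖) * (1 + ‖y‖))) (hk : ∀ y, ‖k y‖ ≤ 1 + ‖y‖) :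
    ∃ D : ℝ, 0 ≤ D ∧ ∀ x y, ‖u (Φ (x, y)) • k y‖ ≤ D * ((1 + ‖x‖) * (1 + ‖y‖) ^ 2) := by
  obtain ⟨D, hD, hu⟩ := hu
  refine ⟨D * (1 + C), by positivity, fun x y ↦ ?_⟩
  rw [norm_smul]
  have h1 : 1 ≤ (1 + ‖x‖) * (1 + ‖y‖) :=
    one_le_mul_of_one_le_of_one_le (by simp) (by simp)
  have h2 : ‖u (Φ (x, y))‖ ≤ D * ((1 + C) * ((1 + ‖x‖) * (1 + ‖y‖))) := by
    refine (hu _).trans (mul_le_mul_of_nonneg_left ?_ hD)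
    linarith [hΦC x y]
  calc ‖u (Φ (x, y))‖ * ‖k y‖ ≤ D * ((1 + C) * ((1 + ‖x‖) * (1 + ‖y‖))) * (1 + ‖y‖) := by
        gcongr
        exact hk y
    _ = _ := by ring

/-! ### Integrating out the noise of one step. -/

section IntegralStep

variable {Ω : Type*} [MeasurableSpace Ω]

lemma integrable_one_add_norm_sq_map {S : Type*} [NormedAddCommGroup S] [MeasurableSpace S]
    [BorelSpace S] {P : Measure Ω} [IsProbabilityMeasure P] {ξ : Ω → S} (hξ : Measurable ξ)
    (hξ2 : MemLp ξ 2 P) :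
    Integrable (fun y : S ↦ (1 + ‖y‖) ^ 2) (P.map ξ) :=
  (integrable_map_measure (by fun_prop) hξ.aemeasurable).2
    ((memLp_two_iff_integrable_sq hξ2.one_add_norm.1).1 hξ2.one_add_norm)

/-- The integrand is bounded by a multiple of `(1 + ‖x‖) (1 + ‖y‖) ^ 2`: the weight `k` only costs a
power of the noise, which has a second moment, while `x` keeps power one. -/
lemma linearGrowth_integral_step {E S G : Type*} [NormedAddCommGroup E]
    [NormedAddCommGroup S] [MeasurableSpace S] [BorelSpace S] [NormedAddCommGroup G]
    [NormedSpace ℝ G] {P : Measure Ω} [IsProbabilityMeasure P] {ξ : Ω → S} {Φ : E × S → E} {C : ℝ}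
    {u : E → ℝ} {k : S → G} (hξ : Measurable ξ) (hξ2 : MemLp ξ 2 P) (hu : LinearGrowth u)
    (hC : 0 ≤ C) (hΦC : ∀ x y, ‖Φ (x, y)‖ ≤ C * ((1 + ‖x‖) * (1 + ‖y‖)))
    (hk : ∀ y, ‖k y‖ ≤ 1 + ‖y‖) :
    LinearGrowth fun x ↦ ∫ y, u (Φ (x, y)) • k y ∂(P.map ξ) := by
  obtain ⟨D, hD, hb⟩ := hu.exists_norm_step_smul_le hC hΦC hk
  refine ⟨D * ∫ y, (1 + ‖y‖) ^ 2 ∂(P.map ξ),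
    mul_nonneg hD (integral_nonneg fun y ↦ by positivity), fun x ↦ ?_⟩
  have hi := integrable_one_add_norm_sq_map hξ hξ2
  refine (norm_integral_le_of_norm_le ((hi.const_mul (1 + ‖x‖)).const_mul D)
    (.of_forall (hb x))).trans_eq ?_
  rw [integral_const_mul, integral_const_mul]
  ring

lemma measurable_integral_step {E S G : Type*} [MeasurableSpace E] [MeasurableSpace S]
    [NormedAddCommGroup G] [NormedSpace ℝ G] [MeasurableSpace G] [BorelSpace G]
    [SecondCountableTopology G] {P : Measure Ω} [IsProbabilityMeasure P] {ξ : Ω → S}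
    {Φ : E × S → E} {u : E → ℝ} {k : S → G} (hΦ : Measurable Φ) (hu : Measurable u)
    (hk : Measurable k) :
    Measurable fun x ↦ ∫ y, u (Φ (x, y)) • k y ∂(P.map ξ) := by
  have hm : Measurable fun p : E × S ↦ u (Φ p) • k p.2 :=
    (hu.comp hΦ).smul (hk.comp measurable_snd)
  exact hm.stronglyMeasurable.integral_prod_right'.measurable

end IntegralStep

/-! ### One step conditioned on the past. -/

section FrozenExpectation

variable {Ω E S G : Type*} {m : MeasurableSpace Ω} [mΩ : MeasurableSpace Ω]
  [NormedAddCommGroup E] [MeasurableSpace E] [BorelSpace E]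
  [NormedAddCommGroup S] [MeasurableSpace S] [BorelSpace S]

lemma indepFun_one_add_norm {P : Measure Ω} {X : Ω → E} {ξ : Ω → S} (hX : Measurable[m] X)
    (hind : Indep m (MeasurableSpace.comap ξ inferInstance) P) :
    IndepFun (fun ω ↦ 1 + ‖X ω‖) (fun ω ↦ 1 + ‖ξ ω‖) P :=
  IndepFun.comp (φ := fun x : E ↦ 1 + ‖x‖) (ψ := fun y : S ↦ 1 + ‖y‖)
    ((IndepFun_iff_Indep X ξ P).2 (indep_of_indep_of_le_left hind hX.comap_le))
    (by fun_prop) (by fun_prop)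

variable
  [NormedAddCommGroup G] [NormedSpace ℝ G] [MeasurableSpace G] [BorelSpace G]
  [SecondCountableTopology G]
  {P : Measure Ω} [IsProbabilityMeasure P] {X : Ω → E} {ξ : Ω → S} {Φ : E × S → E} {C : ℝ}
  {u : E → ℝ} {k : S → G}

/-- A product of two L² variables is in general only in L¹; here independence factorises the
expectation of its square. -/
lemma memLp_two_step (hX : Measurable[m] X) (hX2 : MemLp X 2 P) (hξ2 : MemLp ξ 2 P)
    (hind : Indep m (MeasurableSpace.comap ξ inferInstance) P)
    (hΦC : ∀ x y, ‖Φ (x, y)‖ ≤ C * ((1 + ‖x‖) * (1 + ‖y‖)))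
    (hΦ : AEStronglyMeasurable (fun ω ↦ Φ (X ω, ξ ω)) P) :
    MemLp (fun ω ↦ Φ (X ω, ξ ω)) 2 P := by
  have hi : MemLp (fun ω ↦ (1 + ‖X ω‖) * (1 + ‖ξ ω‖)) 2 P := by
    refine (memLp_two_iff_integrable_sq (hX2.one_add_norm.1.mul hξ2.one_add_norm.1)).2 ?_
    simp only [Pi.mul_apply]
    simp_rw [mul_pow]
    exact IndepFun.integrable_mul
      ((indepFun_one_add_norm hX hind).comp (φ := (· ^ 2)) (ψ := (· ^ 2)) (by fun_prop)
        (by fun_prop))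
      ((memLp_two_iff_integrable_sq hX2.one_add_norm.1).1 hX2.one_add_norm)
      ((memLp_two_iff_integrable_sq hξ2.one_add_norm.1).1 hξ2.one_add_norm)
  refine (hi.const_mul C).mono hΦ (.of_forall fun ω ↦ ?_)
  exact (hΦC _ _).trans (le_abs_self _)

lemma condExp_step [CompleteSpace G] (hm : m ≤ mΩ) (hX : Measurable[m] X) (hX2 : MemLp X 2 P)
    (hξ : Measurable ξ) (hξ2 : MemLp ξ 2 P)
    (hind : Indep m (MeasurableSpace.comap ξ inferInstance) P)
    (hΦ : Measurable Φ) (hu : Measurable u) (hk : Measurable k)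
    (hug : LinearGrowth u) (hC : 0 ≤ C)
    (hΦC : ∀ x y, ‖Φ (x, y)‖ ≤ C * ((1 + ‖x‖) * (1 + ‖y‖))) (hkn : ∀ y, ‖k y‖ ≤ 1 + ‖y‖) :
    P[fun ω ↦ u (Φ (X ω, ξ ω)) • k (ξ ω) | m] =ᵐ[P]
      fun ω ↦ ∫ y, u (Φ (X ω, y)) • k y ∂(P.map ξ) := by
  have hme : Measurable fun p : E × S ↦ u (Φ p) • k p.2 :=
    (hu.comp hΦ).smul (hk.comp measurable_snd)
  refine condExp_comp_of_indep hm hX hξ hind (φ := fun p ↦ u (Φ p) • k p.2)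
    hme.stronglyMeasurable ?_
  obtain ⟨D, hD, hb⟩ := hug.exists_norm_step_smul_le hC hΦC hkn
  have hi : Integrable (fun ω ↦ (1 + ‖X ω‖) * (1 + ‖ξ ω‖) ^ 2) P :=
    IndepFun.integrable_mul
      ((indepFun_one_add_norm hX hind).comp (φ := fun r ↦ r) (ψ := (· ^ 2)) (by fun_prop)
        (by fun_prop))
      (hX2.one_add_norm.integrable (by norm_num))
      ((memLp_two_iff_integrable_sq hξ2.one_add_norm.1).1 hξ2.one_add_norm)
  refine (hi.const_mul D).mono' ?_ (.of_forall fun ω ↦ hb _ _)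
  exact (hme.comp ((hX.mono hm le_rfl).prodMk hξ)).stronglyMeasurable.aestronglyMeasurable

end FrozenExpectation

/-! ### The Euler step as a map. -/

section EulerStep

variable {d : ℕ}

/-- One step of the Euler scheme, as a function of the state and of the noise increment. -/
noncomputable def eulerStep (b : EuclideanSpace ℝ (Fin d) → EuclideanSpace ℝ (Fin d))
    (σ γ : EuclideanSpace ℝ (Fin d) → Matrix (Fin d) (Fin d) ℝ) (δ : ℝ)
    (p : EuclideanSpace ℝ (Fin d) ×
      (EuclideanSpace ℝ (Fin d) × EuclideanSpace ℝ (Fin d) × ℝ)) : EuclideanSpace ℝ (Fin d) :=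
  p.1 + δ • b p.1 + Matrix.toEuclideanCLM (𝕜 := ℝ) (σ p.1).transpose p.2.1 +
    Matrix.toEuclideanCLM (𝕜 := ℝ) (γ p.1) p.2.2.1

/-- The Lipschitz bound concerns `σ` in operator norm, while the scheme applies its transpose. The
adjoint is an isometry, so continuity and growth carry over. -/
lemma toEuclideanCLM_transpose (A : Matrix (Fin d) (Fin d) ℝ) :
    Matrix.toEuclideanCLM (𝕜 := ℝ) A.transpose =
      ContinuousLinearMap.adjoint (Matrix.toEuclideanCLM (𝕜 := ℝ) A) := by
  rw [← ContinuousLinearMap.star_eq_adjoint, ← map_star, Matrix.star_eq_conjTranspose,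
    Matrix.conjTranspose_eq_transpose_of_trivial]

variable {b : EuclideanSpace ℝ (Fin d) → EuclideanSpace ℝ (Fin d)}
  {σ γ : EuclideanSpace ℝ (Fin d) → Matrix (Fin d) (Fin d) ℝ} {δ : ℝ} {K_b K_σ K_γ : ℝ≥0}

lemma continuous_eulerStep (hb : LipschitzWith K_b b)
    (hσ : LipschitzWith K_σ (fun x ↦ Matrix.toEuclideanCLM (𝕜 := ℝ) (σ x)))
    (hγ : LipschitzWith K_γ (fun x ↦ Matrix.toEuclideanCLM (𝕜 := ℝ) (γ x))) :
    Continuous (eulerStep b σ γ δ) := by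
  unfold eulerStep
  simp_rw [toEuclideanCLM_transpose]
  have h1 := hb.continuous
  have h2 : Continuous fun x ↦
      ContinuousLinearMap.adjoint (Matrix.toEuclideanCLM (𝕜 := ℝ) (σ x)) :=
    ContinuousLinearMap.adjoint.continuous.comp hσ.continuous
  have h3 := hγ.continuous
  exact ((continuous_fst.add ((h1.comp continuous_fst).const_smul δ)).add
    ((h2.comp continuous_fst).clm_apply (by fun_prop))).add
    ((h3.comp continuous_fst).clm_apply (by fun_prop))

lemma exists_norm_eulerStep_le (hb : LipschitzWith K_b b)
    (hσ : LipschitzWith K_σ (fun x ↦ Matrix.toEuclideanCLM (𝕜 := ℝ) (σ x)))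
    (hγ : LipschitzWith K_γ (fun x ↦ Matrix.toEuclideanCLM (𝕜 := ℝ) (γ x))) :
    ∃ C : ℝ, 0 ≤ C ∧ ∀ x y, ‖eulerStep b σ γ δ (x, y)‖ ≤ C * ((1 + ‖x‖) * (1 + ‖y‖)) := by
  obtain ⟨B, hB, hb'⟩ := hb.linearGrowth
  obtain ⟨A, hA, hσ'⟩ := hσ.linearGrowth
  obtain ⟨D, hD, hγ'⟩ := hγ.linearGrowth
  refine ⟨1 + |δ| * B + A + D, by positivity, fun x y ↦ ?_⟩
  have hy1 : ‖y.1‖ ≤ 1 + ‖y‖ := (norm_fst_le y).trans (by linarith)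
  have hy2 : ‖y.2.1‖ ≤ 1 + ‖y‖ :=
    ((norm_fst_le y.2).trans (norm_snd_le y)).trans (by linarith)
  have hx := norm_nonneg x
  have hy := norm_nonneg y
  have h1 : ‖x‖ ≤ (1 + ‖x‖) * (1 + ‖y‖) := by nlinarith
  have h2 : ‖δ • b x‖ ≤ |δ| * (B * ((1 + ‖x‖) * (1 + ‖y‖))) := by
    rw [norm_smul, Real.norm_eq_abs]
    gcongr
    refine (hb' x).trans ?_
    gcongr
    nlinarith
  have h3 : ‖Matrix.toEuclideanCLM (𝕜 := ℝ) (σ x).transpose y.1‖ ≤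
      A * (1 + ‖x‖) * (1 + ‖y‖) := by
    rw [toEuclideanCLM_transpose]
    refine (ContinuousLinearMap.le_opNorm _ _).trans ?_
    rw [LinearIsometryEquiv.norm_map]
    gcongr
    exact hσ' x
  have h4 : ‖Matrix.toEuclideanCLM (𝕜 := ℝ) (γ x) y.2.1‖ ≤ D * (1 + ‖x‖) * (1 + ‖y‖) := by
    refine (ContinuousLinearMap.le_opNorm _ _).trans ?_
    gcongr
    exact hγ' x
  have h5 : ‖x + δ • b x‖ ≤ ‖x‖ + ‖δ • b x‖ := norm_add_le _ _
  have h6 : ‖eulerStep b σ γ δ (x, y)‖ ≤ ‖x + δ • b x‖ +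
      ‖Matrix.toEuclideanCLM (𝕜 := ℝ) (σ x).transpose y.1‖ +
      ‖Matrix.toEuclideanCLM (𝕜 := ℝ) (γ x) y.2.1‖ := norm_add₃_le
  linarith

end EulerStep

/-- Backward recursion: a relation that can be solved one step backward can be solved along
`M, M - 1, …, 0`. -/
lemma exists_backward_seq {α : Type*} {p : α → Prop} {R : ℕ → α → α → Prop} {M : ℕ} {a : α}
    (ha : p a) (hstep : ∀ n < M, ∀ y, p y → ∃ x, p x ∧ R n y x) :
    ∃ s : ℕ → α, s M = a ∧ (∀ n ≤ M, p (s n)) ∧ ∀ n < M, R n (s (n + 1)) (s n) := by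
  induction M generalizing p R with
  | zero => exact ⟨fun _ ↦ a, rfl, fun n _ ↦ ha, by simp⟩
  | succ M ih =>
    -- Shifting the relation keeps the terminal value at the end, so the new element is prepended at
    -- index 0.
    obtain ⟨s, hsM, hsp, hsR⟩ := ih (R := fun n ↦ R (n + 1)) ha
      fun n hn ↦ hstep (n + 1) (Nat.succ_lt_succ hn)
    obtain ⟨x, hx, hRx⟩ := hstep 0 M.succ_pos (s 0) (hsp 0 M.zero_le)
    refine ⟨fun n ↦ Nat.casesOn n x s, hsM, fun n hn ↦ ?_, fun n hn ↦ ?_⟩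
    · cases n with
      | zero => exact hx
      | succ n => exact hsp n (Nat.le_of_succ_le_succ hn)
    · cases n with
      | zero => exact hRx
      | succ n => exact hsR n (Nat.lt_of_succ_lt_succ hn)

/-! ### The Euler scheme and its Markov property. -/

section EulerScheme

variable {d : ℕ} {Ω : Type*} [mΩ : MeasurableSpace Ω] {P : Measure Ω}
  {T : ℝ} {F : Filtration ℝ mΩ} {W : ℝ → Ω → EuclideanSpace ℝ (Fin d)}
  {N : Ω → Measure (ℝ × EuclideanSpace ℝ (Fin d))} {ν : Measure (EuclideanSpace ℝ (Fin d))}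
  [IsFiniteMeasure ν] {b : EuclideanSpace ℝ (Fin d) → EuclideanSpace ℝ (Fin d)}
  {σ γ : EuclideanSpace ℝ (Fin d) → Matrix (Fin d) (Fin d) ℝ} {K_b K_σ K_γ : ℝ≥0}
  {x : EuclideanSpace ℝ (Fin d)} {M n : ℕ}

lemma eulerScheme_succ_ae_eq (hν : IsSquareIntegrableLevyMeasure ν)
    (hnoise : IsBrownianPoissonNoise P T F W N ν) {X : Ω → EuclideanSpace ℝ (Fin d)}
    (hX : eulerScheme T M W N ν b σ γ x n =ᵐ[P] X) :
    eulerScheme T M W N ν b σ γ x (n + 1) =ᵐ[P]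
      fun ω ↦ eulerStep b σ γ (stepSize T M) (X ω, noiseIncrement W N ν T M n ω) := by
  filter_upwards [hX, hnoise.ae_compensatedIntegral_eq hν (M := M) (n := n)] with ω h1 h2
  simp only [eulerScheme, eulerStep, h1, h2]
  rfl

variable [IsProbabilityMeasure P]

/-- `F` need not contain the null sets, so adaptedness is proved for a version built from
`noiseIncrement`, which agrees with the scheme almost surely. -/
lemma exists_eulerScheme_ae_eq (hT : 0 < T) (hM : 0 < M) (hν : IsSquareIntegrableLevyMeasure ν)
    (hnoise : IsBrownianPoissonNoise P T F W N ν) (hb : LipschitzWith K_b b)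
    (hσ : LipschitzWith K_σ (fun x ↦ Matrix.toEuclideanCLM (𝕜 := ℝ) (σ x)))
    (hγ : LipschitzWith K_γ (fun x ↦ Matrix.toEuclideanCLM (𝕜 := ℝ) (γ x))) (hn : n ≤ M) :
    ∃ X : Ω → EuclideanSpace ℝ (Fin d), Measurable[F (gridPoint T M n)] X ∧ MemLp X 2 P ∧
      eulerScheme T M W N ν b σ γ x n =ᵐ[P] X := by
  induction n with
  | zero => exact ⟨fun _ ↦ x, measurable_const, memLp_const x, .of_forall fun ω ↦ rfl⟩
  | succ n ih =>
    obtain ⟨X, hXm, hX2, hX⟩ := ih (Nat.le_of_succ_le hn)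
    have hcont := continuous_eulerStep (δ := stepSize T M) hb hσ hγ
    obtain ⟨C, -, hΦC⟩ := exists_norm_eulerStep_le (δ := stepSize T M) hb hσ hγ
    have hm : Measurable[F (gridPoint T M (n + 1))] fun ω ↦
        eulerStep b σ γ (stepSize T M) (X ω, noiseIncrement W N ν T M n ω) :=
      hcont.measurable.comp ((hXm.mono (F.mono (gridPoint_le_succ hT hM)) le_rfl).prodMk
        (hnoise.measurable_noiseIncrement_filtration hT hM hn))
    exact ⟨_, hm, memLp_two_step hXm hX2 (hnoise.memLp_noiseIncrement hν hT hM hn)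
      (hnoise.indep_noiseIncrement hT hM hn) hΦC
      (hm.mono (F.le _) le_rfl).stronglyMeasurable.aestronglyMeasurable,
      eulerScheme_succ_ae_eq hν hnoise hX⟩

/-- The single Markov step behind all three conditional expectations: `k` will be the Brownian
coordinate, the jump count coordinate and the constant 1. -/
lemma condExp_eulerScheme_succ {G : Type*} [NormedAddCommGroup G] [NormedSpace ℝ G]
    [CompleteSpace G] [MeasurableSpace G] [BorelSpace G] [SecondCountableTopology G]
    (hT : 0 < T) (hM : 0 < M) (hν : IsSquareIntegrableLevyMeasure ν)
    (hnoise : IsBrownianPoissonNoise P T F W N ν) (hb : LipschitzWith K_b b)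
    (hσ : LipschitzWith K_σ (fun x ↦ Matrix.toEuclideanCLM (𝕜 := ℝ) (σ x)))
    (hγ : LipschitzWith K_γ (fun x ↦ Matrix.toEuclideanCLM (𝕜 := ℝ) (γ x))) (hn : n < M)
    {u : EuclideanSpace ℝ (Fin d) → ℝ} (hu : Measurable u) (hug : LinearGrowth u)
    {k : EuclideanSpace ℝ (Fin d) × EuclideanSpace ℝ (Fin d) × ℝ → G} (hk : Measurable k)
    (hkn : ∀ y, ‖k y‖ ≤ 1 + ‖y‖) :
    ∃ v : EuclideanSpace ℝ (Fin d) → G, Measurable v ∧ LinearGrowth v ∧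
      P[fun ω ↦ u (eulerScheme T M W N ν b σ γ x (n + 1) ω) • k (noiseIncrement W N ν T M n ω) |
        F (gridPoint T M n)] =ᵐ[P] fun ω ↦ v (eulerScheme T M W N ν b σ γ x n ω) := by
  obtain ⟨X, hXm, hX2, hX⟩ := exists_eulerScheme_ae_eq (x := x) hT hM hν hnoise hb hσ hγ hn.le
  have hΦ := (continuous_eulerStep (δ := stepSize T M) hb hσ hγ).measurable
  obtain ⟨C, hC, hΦC⟩ := exists_norm_eulerStep_le (δ := stepSize T M) hb hσ hγ
  have hξ := hnoise.measurable_noiseIncrement_ambient hT hM hn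
  have hξ2 := hnoise.memLp_noiseIncrement hν hT hM hn
  refine ⟨_, measurable_integral_step (P := P) (ξ := noiseIncrement W N ν T M n) hΦ hu hk,
    linearGrowth_integral_step hξ hξ2 hug hC hΦC hkn, ?_⟩
  have h1 := condExp_step (F.le _) hXm hX2 hξ hξ2 (hnoise.indep_noiseIncrement hT hM hn) hΦ hu hk
    hug hC hΦC hkn
  refine (condExp_congr_ae ?_).trans (h1.trans ?_)
  · filter_upwards [eulerScheme_succ_ae_eq hν hnoise hX] with ω hω
    rw [hω]
  · filter_upwards [hX] with ω hω
    rw [hω]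

lemma LinearGrowth.memLp_eulerScheme {G : Type*} [NormedAddCommGroup G] [MeasurableSpace G]
    [BorelSpace G] [SecondCountableTopology G]
    (hT : 0 < T) (hM : 0 < M) (hν : IsSquareIntegrableLevyMeasure ν)
    (hnoise : IsBrownianPoissonNoise P T F W N ν) (hb : LipschitzWith K_b b)
    (hσ : LipschitzWith K_σ (fun x ↦ Matrix.toEuclideanCLM (𝕜 := ℝ) (σ x)))
    (hγ : LipschitzWith K_γ (fun x ↦ Matrix.toEuclideanCLM (𝕜 := ℝ) (γ x))) (hn : n ≤ M)
    {v : EuclideanSpace ℝ (Fin d) → G} (hvg : LinearGrowth v) (hv : Measurable v) :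
    MemLp (fun ω ↦ v (eulerScheme T M W N ν b σ γ x n ω)) 2 P := by
  obtain ⟨X, hXm, hX2, hX⟩ := exists_eulerScheme_ae_eq (x := x) hT hM hν hnoise hb hσ hγ hn
  obtain ⟨C, hC, hvC⟩ := hvg
  have h1 : MemLp (fun ω ↦ v (X ω)) 2 P := by
    refine (hX2.one_add_norm.const_mul C).mono
      (hv.comp (hXm.mono (F.le _) le_rfl)).stronglyMeasurable.aestronglyMeasurable
      (.of_forall fun ω ↦ (hvC _).trans (le_abs_self _))
  refine h1.ae_eq ?_
  filter_upwards [hX] with ω hω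
  rw [hω]

end EulerScheme

lemma LinearGrowth.const_smul {E G : Type*} [NormedAddCommGroup E] [NormedAddCommGroup G]
    [NormedSpace ℝ G] {v : E → G} (hv : LinearGrowth v) (c : ℝ) :
    LinearGrowth fun x ↦ c • v x := by
  obtain ⟨C, hC, hv⟩ := hv
  refine ⟨|c| * C, by positivity, fun x ↦ ?_⟩
  rw [norm_smul, Real.norm_eq_abs, mul_assoc]
  gcongr
  exact hv x

theorem lemma4p3 {d : ℕ} {Ω : Type*} [mΩ : MeasurableSpace Ω]
    (P : Measure Ω) [IsProbabilityMeasure P]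
    (T : ℝ) (hT : 0 < T) (F : Filtration ℝ mΩ)
    (W : ℝ → Ω → EuclideanSpace ℝ (Fin d))
    (N : Ω → Measure (ℝ × EuclideanSpace ℝ (Fin d)))
    (ν : Measure (EuclideanSpace ℝ (Fin d))) [IsFiniteMeasure ν]
    (hν : IsSquareIntegrableLevyMeasure ν)
    (hnoise : IsBrownianPoissonNoise P T F W N ν)
    (b : EuclideanSpace ℝ (Fin d) → EuclideanSpace ℝ (Fin d))
    (σ γ : EuclideanSpace ℝ (Fin d) → Matrix (Fin d) (Fin d) ℝ)
    (f : ℝ → EuclideanSpace ℝ (Fin d) → ℝ → EuclideanSpace ℝ (Fin d) → ℝ → ℝ)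
    (g : EuclideanSpace ℝ (Fin d) → ℝ)
    (K_b K_σ K_γ K_g : ℝ≥0) (K_f : ℝ)
    (hb : LipschitzWith K_b b)
    (hσ : LipschitzWith K_σ (fun x ↦ Matrix.toEuclideanCLM (𝕜 := ℝ) (σ x)))
    (hγ : LipschitzWith K_γ (fun x ↦ Matrix.toEuclideanCLM (𝕜 := ℝ) (γ x)))
    (hg : LipschitzWith K_g g)
    (hK_f : 0 < K_f)
    (hf : ∀ t ∈ Icc 0 T, ∀ x x' y y' z z' u u',
      |f t x y z u - f t x' y' z' u'| ≤ K_f * (‖x - x'‖ + |y - y'| + ‖z - z'‖ + |u - u'|))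
    (x : EuclideanSpace ℝ (Fin d)) (M : ℕ) (hM : 0 < M)
    (hΔt : stepSize T M < 1 / K_f) :
    ∃ (U : ℕ → EuclideanSpace ℝ (Fin d) → ℝ)
      (V : ℕ → EuclideanSpace ℝ (Fin d) → EuclideanSpace ℝ (Fin d))
      (L : ℕ → EuclideanSpace ℝ (Fin d) → ℝ),
      (∀ n ≤ M, Measurable (U n) ∧ Measurable (V n) ∧ Measurable (L n)) ∧
      IsBackwardSolution P T M F W N ν f g (eulerScheme T M W N ν b σ γ x)
        (fun n ω ↦ U n (eulerScheme T M W N ν b σ γ x n ω))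
        (fun n ω ↦ V n (eulerScheme T M W N ν b σ γ x n ω))
        (fun n ω ↦ L n (eulerScheme T M W N ν b σ γ x n ω)) := by
  have hδ := stepSize_pos hT hM
  set X := eulerScheme T M W N ν b σ γ x with hXdef
  -- The invariant of the backward recursion on triples `(U n, V n, L n)`; linear growth is what
  -- makes every conditional expectation genuine.
  let p : (EuclideanSpace ℝ (Fin d) → ℝ) × (EuclideanSpace ℝ (Fin d) → EuclideanSpace ℝ (Fin d)) ×
      (EuclideanSpace ℝ (Fin d) → ℝ) → Prop := fun s ↦
    (Measurable s.1 ∧ LinearGrowth s.1) ∧ (Measurable s.2.1 ∧ LinearGrowth s.2.1) ∧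
      (Measurable s.2.2 ∧ LinearGrowth s.2.2)
  let R : ℕ → _ → _ → Prop := fun n
      (s' s : (EuclideanSpace ℝ (Fin d) → ℝ) ×
        (EuclideanSpace ℝ (Fin d) → EuclideanSpace ℝ (Fin d)) ×
        (EuclideanSpace ℝ (Fin d) → ℝ)) ↦
    ((fun ω ↦ s.2.1 (X n ω)) =ᵐ[P] fun ω ↦ (1 / stepSize T M) •
      (P[fun ω' ↦ s'.1 (X (n + 1) ω') • brownianIncrement W T M n ω' |
        F (gridPoint T M n)]) ω) ∧
    ((fun ω ↦ s.2.2 (X n ω)) =ᵐ[P] fun ω ↦ (1 / stepSize T M) *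
      (P[fun ω' ↦ s'.1 (X (n + 1) ω') * compensatedJumpIncrement N ν T M n ω' |
        F (gridPoint T M n)]) ω) ∧
    ((fun ω ↦ s.1 (X n ω)) =ᵐ[P] fun ω ↦
      (P[fun ω' ↦ s'.1 (X (n + 1) ω') | F (gridPoint T M n)]) ω +
        f (gridPoint T M n) (X n ω) (s.1 (X n ω)) (s.2.1 (X n ω)) (s.2.2 (X n ω)) * stepSize T M)
  have hterm : p (g, 0, 0) :=
    ⟨⟨hg.continuous.measurable, hg.linearGrowth⟩, ⟨measurable_const, .zero⟩,
      measurable_const, .zero⟩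
  have hstep : ∀ n < M, ∀ s', p s' → ∃ s, p s ∧ R n s' s := by
    rintro n hn ⟨u', v', l'⟩ ⟨⟨hu', hug'⟩, -⟩
    obtain ⟨v, hv, hvg, hvE⟩ := condExp_eulerScheme_succ (x := x) hT hM hν hnoise hb hσ hγ hn
      hu' hug' (k := fun y ↦ y.1) measurable_fst
      fun y ↦ (norm_fst_le y).trans (le_add_of_nonneg_left zero_le_one)
    obtain ⟨l, hl, hlg, hlE⟩ := condExp_eulerScheme_succ (x := x) hT hM hν hnoise hb hσ hγ hn
      hu' hug' (k := fun y ↦ y.2.2) (by fun_prop)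
      fun y ↦ ((norm_snd_le y.2).trans (norm_snd_le y)).trans (le_add_of_nonneg_left zero_le_one)
    obtain ⟨a, ha, hag, haE⟩ := condExp_eulerScheme_succ (x := x) hT hM hν hnoise hb hσ hγ hn
      hu' hug' (k := fun _ ↦ (1 : ℝ)) measurable_const fun y ↦ by simp
    simp only [smul_eq_mul, mul_one] at haE
    obtain ⟨C, h, hLip, hfix⟩ := exists_lipschitzWith_implicit_step hK_f hδ.le hΔt
      (hf (gridPoint T M n) (gridPoint_mem_Icc hT hM hn.le))
    have hvg' := hvg.const_smul (1 / stepSize T M)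
    have hlg' := hlg.const_smul (1 / stepSize T M)
    have hvm := hv.const_smul (1 / stepSize T M)
    have hlm := hl.const_smul (1 / stepSize T M)
    -- `v`, `l` and `a` represent the conditional expectations with weights `ΔW`, jump count and 1.
    -- The first two, divided by `Δt`, are the new `V` and `L`; the new `U` feeds all of them into
    -- the implicit solution `h`.
    refine ⟨(fun y ↦ h (y, a y, (1 / stepSize T M) • v y, (1 / stepSize T M) • l y),
      fun y ↦ (1 / stepSize T M) • v y, fun y ↦ (1 / stepSize T M) • l y),
      ⟨⟨hLip.continuous.measurable.comp
          (measurable_id.prodMk (ha.prodMk (hvm.prodMk hlm))),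
        hLip.linearGrowth.comp (LinearGrowth.id.prodMk (hag.prodMk (hvg'.prodMk hlg')))⟩,
        ⟨hvm, hvg'⟩, hlm, hlg'⟩, ?_, ?_, ?_⟩
    · filter_upwards [hvE] with ω hω
      exact congrArg _ hω.symm
    · filter_upwards [hlE] with ω hω
      exact congrArg _ hω.symm
    · filter_upwards [haE] with ω hω
      rw [hω]
      exact hfix _ _ _ _
  obtain ⟨s, hsM, hsp, hsR⟩ := exists_backward_seq hterm hstep
  refine ⟨fun n ↦ (s n).1, fun n ↦ (s n).2.1, fun n ↦ (s n).2.2,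
    fun n hn ↦ ⟨(hsp n hn).1.1, (hsp n hn).2.1.1, (hsp n hn).2.2.1⟩, ?_⟩
  exact
    { memLp_Y := fun n hn ↦
        (hsp n hn).1.2.memLp_eulerScheme hT hM hν hnoise hb hσ hγ hn (hsp n hn).1.1
      memLp_Z := fun n hn ↦
        (hsp n hn).2.1.2.memLp_eulerScheme hT hM hν hnoise hb hσ hγ hn (hsp n hn).2.1.1
      memLp_Ψ := fun n hn ↦
        (hsp n hn).2.2.2.memLp_eulerScheme hT hM hν hnoise hb hσ hγ hn (hsp n hn).2.2.1
      terminal_Y := by simp only [hsM]; rfl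
      terminal_Z := by simp only [hsM]; rfl
      terminal_Ψ := by simp only [hsM]; rfl
      Z_eq := fun n hn ↦ (hsR n hn).1
      Ψ_eq := fun n hn ↦ (hsR n hn).2.1
      Y_eq := fun n hn ↦ (hsR n hn).2.2 }
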